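/- Let $\eta\in\{0,1\}^{\mathbb Z}$ be a non-periodic sequence and let $p_1\mid p_2\mid p_3\mid\cdots$, $p_n\to\infty$, be positive integers. Put $\mathcal P_n^i=\{k\in\mathbb Z:\eta_{k+p_nm}=i\text{ for all }m\in\mathbb Z\}$ for $i=0,1$, and assume that $(p_n)$ is a period structure of $\eta$: every $k\in\mathbb Z$ lies in some $\mathcal P_n^0\cup\mathcal P_n^1$ (so $\eta$ is a Toeplitz sequence), and for each $n$ there is $N$ such that $p_n$ divides every integer $q$ with $\mathcal P_N^0+q=\mathcal P_N^0$ and $\mathcal P_N^1+q=\mathcal P_N^1$ (true with $N=n$ if $p_n$ is an essential period; in general this says that the odometer below is a factor of the Toeplitz shift, hence its maximal equicontinuous factor). Let $X_\eta$ be the orbit closure of $\eta$ under the left shift $\sigma$ on $\{0,1\}^{\mathbb Z}$, and let $\operatorname{Aut}_\sigma(X_\eta)$ (the centralizer) be the group of all homeomorphisms of $X_\eta$ onto itself commuting with $\sigma$; it is called trivial if it equals $\langle\sigma\rangle$. Let $G=\varprojlim\mathbb Z/p_n\mathbb Z$, $\Delta:\mathbb Z\to G$, $\Delta(k)=(k \bmod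 p_n)_n$, and let $\pi:X_\eta\to G$ be the unique continuous map with $\pi(\eta)=\Delta(0)$ and $\pi(\sigma x)=\pi(x)+\Delta(1)$. For $F\in\operatorname{Aut}_\sigma(X_\eta)$ let $y_F=\pi(F(\eta))$; then $\pi(F(x))=\pi(x)+y_F$ for all $x\in X_\eta$. Let $V^1=\bigcup_n\bigcup_{k\in\mathcal P_n^1\cap[0,p_n)}\{g\in G:g_n=\Delta(k)_n\}$, let $W=\overline{V^1}$, and let $\partial W$ be its topological boundary in $G$. Let $\mathcal H_n=\mathbb Z\setminus(\mathcal P_n^0\cup\mathcal P_n^1)$ be the set of holes and $\widetilde{\mathcal H}_n=\{k\in\mathcal H_n:\mathcal H_m\cap(k+p_n\mathbb Z)\ne\emptyset\text{ for all }m\ge n\}$ the set of essential holes at level $n$, and let $\tilde\tau_n$ be the minimal period of $\widetilde{\mathcal H}_n$ (it divides $p_n$). a) If $F\in\operatorname{Aut}_\sigma(X_\eta)$ and $k_F\in\mathbb Z$ satisfy $\partial W+y_F\subseteq\partial W+\Delta(k_F)$, then $\tilde\tau_n\mid (y_F)_n-k_F$ in $\mathbb Z/p_n\mathbb Z$ for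 every $n$. In particular, if every $F\in\operatorname{Aut}_\sigma(X_\eta)$ admits such an integer $k_F$ and $\tilde\tau_n=p_n$ for infinitely many $n$, then $\operatorname{Aut}_\sigma(X_\eta)=\langle\sigma\rangle$. b) Suppose that for every $F\in\operatorname{Aut}_\sigma(X_\eta)$ there is a unique $k_F\in\mathbb Z$ with $\partial W+y_F\subseteq\partial W+\Delta(k_F)$, and that $M:=\liminf_{n\to\infty}p_n/\tilde\tau_n<\infty$. Then the elements of finite order of $\operatorname{Aut}_\sigma(X_\eta)$ form a subgroup $\operatorname{Tor}$, $\operatorname{Aut}_\sigma(X_\eta)=\langle\sigma\rangle\oplus\operatorname{Tor}$ (internal direct product), and $\operatorname{Tor}$ is a finite cyclic group (possibly trivial) whose order divides $M$. -/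

import Mathlib

open Set Filter Topology

/-! ## The subshift generated by a sequence, and its automorphism group -/

/-- The left shift `σ` on `{0,1}^ℤ`, `(σ x)_k = x_{k+1}`. -/
def fullShift : (ℤ → Fin 2) ≃ₜ (ℤ → Fin 2) where
  toFun x k := x (k + 1)
  invFun x k := x (k - 1)
  left_inv x := by funext k; simp
  right_inv x := by funext k; simp
  continuous_toFun := by fun_prop
  continuous_invFun := by fun_prop

/-- The point `σ^m η` of the orbit of `η`. -/
def shiftOrbit (η : ℤ → Fin 2) (m : ℤ) : ℤ → Fin 2 := fun k => η (k + m)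

/-- `X_η`: the closure of the orbit `{σ^m η : m ∈ ℤ}` in the product topology. -/
def orbitClosure (η : ℤ → Fin 2) : Set (ℤ → Fin 2) := closure (range (shiftOrbit η))

theorem fullShift_mem_orbitClosure (η x : ℤ → Fin 2) :
    x ∈ orbitClosure η ↔ fullShift x ∈ orbitClosure η := by
  have h : fullShift '' orbitClosure η = orbitClosure η := by
    unfold orbitClosure
    rw [fullShift.image_closure]
    congr 1
    ext y
    constructor
    · rintro ⟨_, ⟨m, rfl⟩, rfl⟩
      refine ⟨m + 1, ?_⟩
      funext k
      change η (k + (m + 1)) = η (k + 1 + m)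
      congr 1; ring
    · rintro ⟨m, rfl⟩
      refine ⟨_, ⟨m - 1, rfl⟩, ?_⟩
      funext k
      change η (k + 1 + (m - 1)) = η (k + m)
      congr 1; ring
  constructor
  · intro hx
    rw [← h]
    exact mem_image_of_mem _ hx
  · intro hx
    rw [← h] at hx
    obtain ⟨y, hy, hxy⟩ := hx
    exact fullShift.injective hxy ▸ hy

/-- The left shift `σ` as a self-homeomorphism of `X_η`. -/
def subshift (η : ℤ → Fin 2) : orbitClosure η ≃ₜ orbitClosure η :=
  fullShift.subtype (fullShift_mem_orbitClosure η)

/-- `Aut_σ(X_η)`: the group (under composition) of all homeomorphisms of `X_η` onto itself that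
commute with the shift. -/
def shiftAut (η : ℤ → Fin 2) : Subgroup (orbitClosure η ≃ₜ orbitClosure η) :=
  Subgroup.centralizer {subshift η}

/-- The shift, as an element of `Aut_σ(X_η)`. -/
def shiftAutGen (η : ℤ → Fin 2) : shiftAut η :=
  ⟨subshift η, by simp [shiftAut, Subgroup.mem_centralizer_iff]⟩

/-- The sequence `η` itself, as a point of `X_η`. -/
def basePoint (η : ℤ → Fin 2) : orbitClosure η :=
  ⟨η, subset_closure ⟨0, by funext k; simp [shiftOrbit]⟩⟩

/-! ## Toeplitz sequences -/

/-- The set of positions `k` such that `η` is constant with value `i` on `k + qℤ`. -/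
def periodicPositions (η : ℤ → Fin 2) (q : ℕ) (i : Fin 2) : Set ℤ :=
  {k | ∀ m : ℤ, η (k + q * m) = i}

/-- A period structure of `η`: positive integers `p 0 ∣ p 1 ∣ p 2 ∣ ⋯` tending to infinity such that
every position `k` is `p n`-periodic for some `n` (that is, `η` is a Toeplitz sequence), and such
that each `p n` divides every period of the pair of sets of `p N`-periodic positions, for some `N`.
The last condition holds with `N = n` if `p n` is an essential period of `η`; in general it says
precisely that the odometer built from `p` is a factor of the orbit closure of `η` (hence its
maximal equicontinuous factor). -/
structure PeriodStructure (η : ℤ → Fin 2) where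
  p : ℕ → ℕ
  pos : ∀ n, 0 < p n
  dvd : ∀ n, p n ∣ p (n + 1)
  tendsto : Tendsto p atTop atTop
  toeplitz : ∀ k : ℤ, ∃ n, ∃ i, k ∈ periodicPositions η (p n) i
  essential : ∀ n, ∃ N, ∀ q : ℤ,
    (∀ i k, k + q ∈ periodicPositions η (p N) i ↔ k ∈ periodicPositions η (p N) i) → (p n : ℤ) ∣ q

/-- The minimal period of a set of integers: the least positive integer `q` with `A + q = A`
(and `0` if there is none). -/
noncomputable def minPeriod (A : Set ℤ) : ℕ :=
  sInf {q : ℕ | 0 < q ∧ ∀ k : ℤ, k + q ∈ A ↔ k ∈ A}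

namespace PeriodStructure

variable {η : ℤ → Fin 2} (P : PeriodStructure η)

/-- `𝒫_n^i`. -/
def per (n : ℕ) (i : Fin 2) : Set ℤ := periodicPositions η (P.p n) i

/-- `ℋ_n`: the set of holes at level `n`. -/
def holes (n : ℕ) : Set ℤ := (P.per n 0 ∪ P.per n 1)ᶜ

/-- `ℋ̃_n`: the set of essential holes at level `n`. -/
def essHoles (n : ℕ) : Set ℤ :=
  {k | k ∈ P.holes n ∧ ∀ m, n ≤ m → (P.holes m ∩ {l : ℤ | ∃ j : ℤ, l = k + P.p n * j}).Nonempty}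

/-- `τ̃_n`: the minimal period of the set of essential holes at level `n`. -/
noncomputable def tau (n : ℕ) : ℕ := minPeriod (P.essHoles n)

/-- The odometer group `G = lim ℤ/p_nℤ`, with the topology induced by the product of the discrete
topologies. -/
def odometer : AddSubgroup (∀ n, ZMod (P.p n)) where
  carrier := {g | ∀ n, ZMod.castHom (P.dvd n) (ZMod (P.p n)) (g (n + 1)) = g n}
  zero_mem' n := by simp
  add_mem' {a b} ha hb n := by
    rw [Pi.add_apply, map_add, ha n, hb n, Pi.add_apply]
  neg_mem' {a} ha n := by
    rw [Pi.neg_apply, map_neg, ha n, Pi.neg_apply]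

/-- The diagonal embedding `Δ : ℤ → G`. -/
def diag : ℤ →+ P.odometer where
  toFun k := ⟨fun n => (k : ZMod (P.p n)), fun n => map_intCast _ k⟩
  map_zero' := by ext n; simp
  map_add' a b := by ext n; simp

/-- The cylinder set `U_n(h) = {g ∈ G : g_n = h_n}`. -/
def cyl (n : ℕ) (h : P.odometer) : Set P.odometer := {g | g.1 n = h.1 n}

/-- `V^i`: the union of the cylinders `U_n(Δ(k))` over all `n` and all `k ∈ 𝒫_n^i ∩ [0, p_n)`. -/
def openPart (i : Fin 2) : Set P.odometer :=
  ⋃ n : ℕ, ⋃ k ∈ P.per n i ∩ Ico (0 : ℤ) (P.p n), P.cyl n (P.diag k)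

/-- The window `W`, the closure of `V^1`. -/
def window : Set P.odometer := closure (P.openPart 1)

/-- `∂W`, the topological boundary of the window in `G`. -/
def bdry : Set P.odometer := frontier P.window

/-! ### The factor map onto the odometer -/

theorem dvd_of_le {m n : ℕ} (h : m ≤ n) : P.p m ∣ P.p n :=
  Nat.le_induction dvd_rfl (fun _ _ ih => ih.trans (P.dvd _)) n h

/-- Some finite window of the sequence determines the position modulo `p n`. -/
theorem exists_finset (n : ℕ) : ∃ S : Finset ℤ, ∀ m m' : ℤ,
    (∀ i ∈ S, η (i + m) = η (i + m')) → (m : ZMod (P.p n)) = m' := by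
  obtain ⟨N, hN⟩ := P.essential n
  have hpN : (0 : ℤ) < P.p N := by exact_mod_cast P.pos N
  -- choose positions showing that a class is not constant with value `i`
  have h1 : ∀ (c : ℤ) (i : Fin 2), ∃ a : ℤ, c ∉ periodicPositions η (P.p N) i →
      (P.p N : ℤ) ∣ a - c ∧ η a ≠ i := by
    intro c i
    by_cases hc : c ∈ periodicPositions η (P.p N) i
    · exact ⟨0, fun h => absurd hc h⟩
    · simp only [periodicPositions, mem_ofPred_eq, not_forall] at hc
      obtain ⟨m, hm⟩ := hc
      exact ⟨c + P.p N * m, fun _ => ⟨⟨m, by ring⟩, hm⟩⟩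
  choose a ha using h1
  choose lev val hlev using P.toeplitz
  -- a common level at which all these positions are periodic
  let L : ℕ := (Finset.Ico (0 : ℤ) (P.p N)).sup (fun c => lev (a c 0) ⊔ lev (a c 1))
  have hL : ∀ c ∈ Finset.Ico (0 : ℤ) (P.p N), ∀ i, lev (a c i) ≤ L := by
    intro c hc i
    have := Finset.le_sup (f := fun c => lev (a c 0) ⊔ lev (a c 1)) hc
    have h2 : lev (a c i) ≤ lev (a c 0) ⊔ lev (a c 1) := by
      fin_cases i
      · exact le_sup_left
      · exact le_sup_right
    exact h2.trans this
  let K : ℕ := max L N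
  have hpK : (0 : ℤ) < P.p K := by exact_mod_cast P.pos K
  have hNK : (P.p N : ℤ) ∣ P.p K := by exact_mod_cast P.dvd_of_le (le_max_right L N)
  have key : ∀ m m' : ℤ, (∀ i ∈ Finset.Ico (0 : ℤ) (P.p K), η (i + m) = η (i + m')) →
      ∀ i k, k ∈ periodicPositions η (P.p N) i → k + (m' - m) ∈ periodicPositions η (P.p N) i := by
    intro m m' hmm i k hk
    by_contra hcon
    set c : ℤ := (k + (m' - m)) % P.p N with hc
    have hc1 : c ∈ Finset.Ico (0 : ℤ) (P.p N) :=
      Finset.mem_Ico.2 ⟨Int.emod_nonneg _ hpN.ne', Int.emod_lt_of_pos _ hpN⟩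
    have hc2 : (P.p N : ℤ) ∣ c - (k + (m' - m)) := by
      rw [hc]; exact ⟨-((k + (m' - m)) / P.p N), by have := Int.emod_add_mul_ediv (k + (m' - m)) (P.p N); linarith⟩
    have hc3 : c ∉ periodicPositions η (P.p N) i := by
      intro h
      apply hcon
      obtain ⟨d, hd⟩ := hc2
      intro j
      have := h (j - d)
      rw [← this]
      congr 1
      linear_combination (-1) * hd
    obtain ⟨ha1, ha2⟩ := ha c i hc3
    -- transport the position into the window
    set t : ℤ := (a c i - m') % P.p K with ht
    have ht1 : t ∈ Finset.Ico (0 : ℤ) (P.p K) :=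
      Finset.mem_Ico.2 ⟨Int.emod_nonneg _ hpK.ne', Int.emod_lt_of_pos _ hpK⟩
    have ht2 : (P.p K : ℤ) ∣ (t + m') - a c i := by
      rw [ht]; exact ⟨-((a c i - m') / P.p K), by have := Int.emod_add_mul_ediv (a c i - m') (P.p K); linarith⟩
    have ht3 : η (t + m') = η (a c i) := by
      have hd : (P.p (lev (a c i)) : ℤ) ∣ (t + m') - a c i :=
        dvd_trans (by exact_mod_cast P.dvd_of_le ((hL c hc1 i).trans (le_max_left L N))) ht2
      obtain ⟨d, hd⟩ := hd
      have e1 := hlev (a c i) d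
      have e2 := hlev (a c i) 0
      rw [mul_zero, add_zero] at e2
      rw [e2, ← e1]
      congr 1
      linarith
    have ht4 : η (t + m) = i := by
      have hd : (P.p N : ℤ) ∣ (t + m) - k := by
        have : (t + m) - k = ((t + m') - a c i) + (a c i - c) + (c - (k + (m' - m))) := by ring
        rw [this]
        exact dvd_add (dvd_add (hNK.trans ht2) ha1) hc2
      obtain ⟨d, hd⟩ := hd
      rw [← hk d]
      congr 1
      linarith
    exact ha2 (by rw [← ht3, ← hmm t ht1, ht4])
  refine ⟨Finset.Ico (0 : ℤ) (P.p K), fun m m' hmm => ?_⟩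
  rw [ZMod.intCast_eq_intCast_iff_dvd_sub]
  refine hN _ fun i k => ⟨fun h => ?_, key m m' hmm i k⟩
  have := key m' m (fun j hj => (hmm j hj).symm) i _ h
  have e : k + (m' - m) + (m - m') = k := by ring
  rwa [e] at this

/-- Every point of `X_η` agrees on every finite set of positions with a shift of `η`. -/
theorem exists_agree (x : orbitClosure η) (S : Finset ℤ) :
    ∃ m : ℤ, ∀ i ∈ S, x.1 i = η (i + m) := by
  have hU : IsOpen {y : ℤ → Fin 2 | ∀ i ∈ S, y i = x.1 i} := by
    have : {y : ℤ → Fin 2 | ∀ i ∈ S, y i = x.1 i} = (S : Set ℤ).pi fun i => {x.1 i} := by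
      ext y; simp [Set.pi]
    rw [this]
    exact isOpen_set_pi S.finite_toSet fun _ _ => isOpen_discrete _
  obtain ⟨y, hy, m, rfl⟩ := mem_closure_iff.1 x.2 _ hU fun _ _ => rfl
  exact ⟨m, fun i hi => (hy i hi).symm⟩

theorem denseRange_orbit : DenseRange fun m : ℤ =>
    (⟨shiftOrbit η m, subset_closure ⟨m, rfl⟩⟩ : orbitClosure η) := by
  rw [DenseRange, Subtype.dense_iff]
  intro x hx
  refine closure_mono ?_ hx
  rintro _ ⟨m, rfl⟩
  exact ⟨_, ⟨m, rfl⟩, rfl⟩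

/-- A closed set containing `η` that is invariant under `σ` and `σ⁻¹` is all of `X_η`. -/
theorem orbit_induction {C : Set (orbitClosure η)} (hC : IsClosed C) (h0 : basePoint η ∈ C)
    (h1 : ∀ x, x ∈ C ↔ subshift η x ∈ C) (x : orbitClosure η) : x ∈ C := by
  have horb : ∀ m : ℤ, (⟨shiftOrbit η m, subset_closure ⟨m, rfl⟩⟩ : orbitClosure η) ∈ C := by
    have hs : ∀ m : ℤ, subshift η ⟨shiftOrbit η m, subset_closure ⟨m, rfl⟩⟩ =
        ⟨shiftOrbit η (m + 1), subset_closure ⟨m + 1, rfl⟩⟩ := by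
      intro m
      apply Subtype.ext
      funext k
      change η (k + 1 + m) = η (k + (m + 1))
      congr 1; ring
    intro m
    induction m using Int.induction_on with
    | zero =>
      convert h0 using 1
      apply Subtype.ext
      funext k
      simp [shiftOrbit, basePoint]
    | succ m ih => rw [← hs]; exact (h1 _).1 ih
    | pred m ih =>
      rw [h1, hs]
      simpa using ih
  have : closure (range fun m : ℤ =>
      (⟨shiftOrbit η m, subset_closure ⟨m, rfl⟩⟩ : orbitClosure η)) ⊆ C :=
    hC.closure_subset_iff.2 (range_subset_iff.2 horb)
  exact this (denseRange_orbit x)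

/-- There is exactly one factor map `π : (X_η, σ) → (G, T)` with `π(η) = Δ(0)`. -/
theorem existsUnique_factorMap : ∃! π : C(orbitClosure η, P.odometer),
    π (basePoint η) = P.diag 0 ∧ ∀ x, π (subshift η x) = π x + P.diag 1 := by
  choose S hS using P.exists_finset
  choose m hm using fun (n : ℕ) (x : orbitClosure η) => exists_agree x (S n)
  have key : ∀ n x (k : ℤ), (∀ i ∈ S n, x.1 i = η (i + k)) → (m n x : ZMod (P.p n)) = k := by
    intro n x k hk
    exact hS n _ _ fun i hi => by rw [← hm n x i hi, hk i hi]
  let f : orbitClosure η → P.odometer := fun x => ⟨fun n => (m n x : ZMod (P.p n)), by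
    intro n
    obtain ⟨k, hk⟩ := exists_agree x (S n ∪ S (n + 1))
    simp only
    rw [key n x k fun i hi => hk i (Finset.mem_union_left _ hi),
      key (n + 1) x k fun i hi => hk i (Finset.mem_union_right _ hi)]
    exact map_intCast _ k⟩
  have hf : Continuous f := by
    refine Continuous.subtype_mk (continuous_pi fun n => ?_) _
    refine IsLocallyConstant.continuous ((IsLocallyConstant.iff_exists_open _).2 fun x => ?_)
    refine ⟨{y | ∀ i ∈ S n, y.1 i = x.1 i}, ?_, fun _ _ => rfl, fun y hy => ?_⟩
    · have : {y : orbitClosure η | ∀ i ∈ S n, y.1 i = x.1 i} =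
          ⋂ i ∈ S n, (fun y : orbitClosure η => y.1 i) ⁻¹' {x.1 i} := by
        ext y; simp
      rw [this]
      exact isOpen_biInter_finset fun i _ =>
        (isOpen_discrete _).preimage ((continuous_apply i).comp continuous_subtype_val)
    · exact key n y _ fun i hi => by rw [hy i hi, hm n x i hi]
  refine ⟨⟨f, hf⟩, ⟨?_, fun x => ?_⟩, fun g hg => ?_⟩
  · ext n
    change (m n (basePoint η) : ZMod (P.p n)) = ((0 : ℤ) : ZMod (P.p n))
    exact key n _ 0 fun i _ => by simp [basePoint]
  · ext n
    change (m n (subshift η x) : ZMod (P.p n)) = (m n x : ZMod (P.p n)) + ((1 : ℤ) : ZMod (P.p n))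
    obtain ⟨k, hk⟩ := exists_agree x (S n ∪ (S n).image (· + 1))
    rw [key n x k fun i hi => hk i (Finset.mem_union_left _ hi), ← Int.cast_add]
    refine key n _ _ fun i hi => ?_
    have := hk (i + 1) (Finset.mem_union_right _ (Finset.mem_image_of_mem _ hi))
    change x.1 (i + 1) = _
    rw [this]
    congr 1; ring
  · have hcl : IsClosed {x | g x = f x} := isClosed_eq g.continuous hf
    have hf0 : f (basePoint η) = P.diag 0 := by
      ext n
      exact key n _ 0 fun i _ => by simp [basePoint]
    have hf1 : ∀ x, f (subshift η x) = f x + P.diag 1 := by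
      intro x
      ext n
      change (m n (subshift η x) : ZMod (P.p n)) =
        (m n x : ZMod (P.p n)) + ((1 : ℤ) : ZMod (P.p n))
      obtain ⟨k, hk⟩ := exists_agree x (S n ∪ (S n).image (· + 1))
      rw [key n x k fun i hi => hk i (Finset.mem_union_left _ hi), ← Int.cast_add]
      refine key n _ _ fun i hi => ?_
      have := hk (i + 1) (Finset.mem_union_right _ (Finset.mem_image_of_mem _ hi))
      change x.1 (i + 1) = _
      rw [this]
      congr 1; ring
    ext1 x
    refine orbit_induction hcl (by rw [mem_ofPred_eq, hg.1, hf0]) (fun y => ?_) x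
    rw [mem_ofPred_eq, mem_ofPred_eq, hg.2, hf1, add_left_inj]

/-- The factor map `π : (X_η, σ) → (G, T)`, normalized by `π(η) = Δ(0)`. -/
noncomputable def factorMap : C(orbitClosure η, P.odometer) := P.existsUnique_factorMap.choose

theorem factorMap_basePoint : P.factorMap (basePoint η) = P.diag 0 :=
  P.existsUnique_factorMap.choose_spec.1.1

theorem factorMap_shift (x : orbitClosure η) :
    P.factorMap (subshift η x) = P.factorMap x + P.diag 1 :=
  P.existsUnique_factorMap.choose_spec.1.2 x

/-- The element `y_F = π(F(η))` of `G` associated with an automorphism `F`; see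
`factorMap_apply_aut` for its characteristic property. -/
noncomputable def transl (F : shiftAut η) : P.odometer := P.factorMap (F.1 (basePoint η))

theorem factorMap_apply_aut (F : shiftAut η) (x : orbitClosure η) :
    P.factorMap (F.1 x) = P.factorMap x + P.transl F := by
  have hF : ∀ y, F.1 (subshift η y) = subshift η (F.1 y) := fun y =>
    (DFunLike.congr_fun (Subgroup.mem_centralizer_singleton_iff.1 F.2) y)
  refine orbit_induction (C := {x | P.factorMap (F.1 x) = P.factorMap x + P.transl F})
    (isClosed_eq (P.factorMap.continuous.comp F.1.continuous)
      (P.factorMap.continuous.add continuous_const)) ?_ (fun y => ?_) x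
  · rw [mem_ofPred_eq, factorMap_basePoint, map_zero, zero_add, transl]
  · rw [mem_ofPred_eq, mem_ofPred_eq, hF, factorMap_shift, factorMap_shift, add_right_comm,
      add_left_inj]

/-- The inclusion `∂W + y_F ⊆ ∂W + Δ(k)`. -/
def BdryShift (F : shiftAut η) (k : ℤ) : Prop :=
  (fun h => h + P.transl F) '' P.bdry ⊆ (fun h => h + P.diag k) '' P.bdry

/-! ### The minimal period of the essential holes divides `p_n` -/

theorem essHoles_periodic (n : ℕ) (k : ℤ) : k + P.p n ∈ P.essHoles n ↔ k ∈ P.essHoles n := by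
  have h1 : ∀ (k : ℤ) (i : Fin 2), k + P.p n ∈ P.per n i ↔ k ∈ P.per n i := by
    intro k i
    constructor
    · intro h m
      have := h (m - 1)
      rw [← this]; congr 1; ring
    · intro h m
      have := h (m + 1)
      rw [← this]; congr 1; ring
  have h2 : {l : ℤ | ∃ j : ℤ, l = k + P.p n + P.p n * j} = {l : ℤ | ∃ j : ℤ, l = k + P.p n * j} := by
    ext l
    constructor
    · rintro ⟨j, rfl⟩
      exact ⟨j + 1, by ring⟩
    · rintro ⟨j, rfl⟩
      exact ⟨j - 1, by ring⟩
  simp only [essHoles, holes, mem_ofPred_eq, mem_compl_iff, mem_union, h1, h2]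

theorem tau_spec (n : ℕ) :
    0 < P.tau n ∧ ∀ k : ℤ, k + P.tau n ∈ P.essHoles n ↔ k ∈ P.essHoles n :=
  Nat.sInf_mem (s := {q : ℕ | 0 < q ∧ ∀ k : ℤ, k + q ∈ P.essHoles n ↔ k ∈ P.essHoles n})
    ⟨P.p n, P.pos n, P.essHoles_periodic n⟩

/-- `τ̃_n ∣ p_n`, so that the quotient `p_n / τ̃_n` is an integer. -/
theorem tau_dvd (n : ℕ) : P.tau n ∣ P.p n := by
  obtain ⟨h0, h1⟩ := P.tau_spec n
  have h2 : ∀ (j : ℕ) (k : ℤ), k + P.tau n * j ∈ P.essHoles n ↔ k ∈ P.essHoles n := by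
    intro j
    induction j with
    | zero => intro k; simp
    | succ j ih =>
      intro k
      rw [← ih k, ← h1 (k + P.tau n * j)]
      push_cast
      ring_nf
  by_contra hnd
  have hpos : 0 < P.p n % P.tau n := Nat.pos_of_ne_zero fun h => hnd (Nat.dvd_of_mod_eq_zero h)
  have hle : P.tau n ≤ P.p n % P.tau n := by
    refine Nat.sInf_le ⟨hpos, fun k => ?_⟩
    rw [← P.essHoles_periodic n k, ← h2 (P.p n / P.tau n) (k + (P.p n % P.tau n : ℕ)), add_assoc]
    have : (((P.p n % P.tau n : ℕ) : ℤ) + (P.tau n : ℤ) * ((P.p n / P.tau n : ℕ) : ℤ)) = P.p n := by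
      exact_mod_cast Nat.mod_add_div (P.p n) (P.tau n)
    rw [this]
  exact absurd (Nat.mod_lt _ h0) (not_lt.2 hle)

end PeriodStructure

/-! A point of G lies on ∂W exactly when each of its coordinates is a class of holes (`mem_bdry`),
and by compactness the residues of ∂W modulo p_n are exactly the essential holes (`mem_essHoles`).
Read modulo p_n, the inclusion ∂W + y_F ⊆ ∂W + Δ(k) says that translation by (y_F)_n - k maps the
essential holes into themselves. On the finite group ℤ/p_nℤ such a translation preserves them, so it
is a multiple of τ̃_n (`tau_dvd_transl_sub`).

The Toeplitz property makes the fibre of π over 0 the single point η, so F ↦ y_F is an injective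
homomorphism into G (`transl_injective`). If τ̃_n = p_n infinitely often, this forces y_F = Δ(k),
that is F = σ^k.

For b), uniqueness of k_F makes F ↦ k_F a homomorphism to ℤ sending σ to 1, so the centralizer is
the product of ⟨σ⟩ and the kernel. On the kernel, (y_F)_n lies in the cyclic group τ̃_nℤ/p_nℤ, of
order p_n/τ̃_n, which equals M for infinitely many n. Finitely many kernel elements are separated at
all large levels, so the kernel is finite and embeds in a cyclic group of order M. As ℤ is
torsion-free, the kernel is the set of all torsion elements. -/

namespace PeriodStructure

variable {η : ℤ → Fin 2} (P : PeriodStructure η)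

/-! ### Topology and coordinates of the odometer. -/

instance neZero_p (n : ℕ) : NeZero (P.p n) := ⟨(P.pos n).ne'⟩

instance compactSpace_odometer : CompactSpace P.odometer := by
  refine isCompact_iff_compactSpace.1 (IsClosed.isCompact ?_)
  have : (P.odometer : Set (∀ n, ZMod (P.p n))) =
      ⋂ n, {g | ZMod.castHom (P.dvd n) (ZMod (P.p n)) (g (n + 1)) = g n} := by
    ext g
    simp only [mem_iInter]
    rfl
  rw [this]
  refine isClosed_iInter fun n => isClosed_eq ?_ (continuous_apply n)
  exact (continuous_of_discreteTopology
    (f := ZMod.castHom (P.dvd n) (ZMod (P.p n)))).comp (continuous_apply (n + 1))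

theorem continuous_coord (n : ℕ) : Continuous fun g : P.odometer => g.1 n :=
  (continuous_apply n).comp continuous_subtype_val

theorem coord_eq_of_le {g h : P.odometer} {m n : ℕ} (hmn : m ≤ n) (H : g.1 n = h.1 n) :
    g.1 m = h.1 m := by
  induction n, hmn using Nat.le_induction with
  | base => exact H
  | succ n _ ih => exact ih (by rw [← g.2 n, ← h.2 n, H])

theorem ext_of_infinite {g h : P.odometer} {s : Set ℕ} (hs : s.Infinite)
    (H : ∀ n ∈ s, g.1 n = h.1 n) : g = h := by
  refine Subtype.ext (funext fun m => ?_)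
  obtain ⟨n, hn, hmn⟩ := hs.exists_gt m
  exact P.coord_eq_of_le hmn.le (H n hn)

/-- Agreement at level n forces agreement at all lower levels, so each fixed coordinate is
eventually constant along u. -/
theorem tendsto_of_coord_eq {u : ℕ → P.odometer} {g : P.odometer}
    (h : ∀ n, (u n).1 n = g.1 n) : Tendsto u atTop (𝓝 g) := by
  rw [tendsto_subtype_rng, tendsto_pi_nhds]
  intro m
  refine tendsto_const_nhds.congr' ?_
  filter_upwards [eventually_ge_atTop m] with n hn
  exact (P.coord_eq_of_le hn (h n)).symm

/-! ### Periodic positions and holes. -/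

theorem per_congr {n : ℕ} {k l : ℤ} (h : (k : ZMod (P.p n)) = l) {i : Fin 2}
    (hk : k ∈ P.per n i) : l ∈ P.per n i := by
  obtain ⟨d, hd⟩ := (ZMod.intCast_eq_intCast_iff_dvd_sub _ _ _).1 h
  intro m
  rw [← hk (d + m)]
  congr 1
  linear_combination hd

theorem per_mono {m n : ℕ} (h : m ≤ n) (i : Fin 2) : P.per m i ⊆ P.per n i := by
  obtain ⟨d, hd⟩ := P.dvd_of_le h
  intro k hk j
  rw [← hk (d * j), hd]
  congr 1
  push_cast
  ring

theorem mem_holes {n : ℕ} {k : ℤ} : k ∈ P.holes n ↔ ∀ i, k ∉ P.per n i := by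
  simp [holes, Fin.forall_fin_two]

theorem holes_congr {n : ℕ} {k l : ℤ} (h : (k : ZMod (P.p n)) = l) (hk : k ∈ P.holes n) :
    l ∈ P.holes n :=
  P.mem_holes.2 fun i hl => P.mem_holes.1 hk i (P.per_congr h.symm hl)

theorem holes_anti {m n : ℕ} (h : m ≤ n) : P.holes n ⊆ P.holes m := fun _ hk =>
  P.mem_holes.2 fun i hl => P.mem_holes.1 hk i (P.per_mono h i hl)

theorem exists_apply_eq_of_mem_holes {n : ℕ} {k : ℤ} (hk : k ∈ P.holes n) (i : Fin 2) :
    ∃ m : ℤ, η (k + P.p n * m) = i := by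
  by_contra! h
  -- With two symbols, a class that misses i is constant with value 1 - i.
  refine P.mem_holes.1 hk (1 - i) fun m => ?_
  have := h m
  generalize η (k + P.p n * m) = a at this ⊢
  clear h
  revert a i
  decide

/-! ### The open sets V^0, V^1 and the boundary of the window. -/

theorem mem_openPart {i : Fin 2} {g : P.odometer} :
    g ∈ P.openPart i ↔ ∃ n, ∃ k ∈ P.per n i, g.1 n = k := by
  simp only [openPart, mem_iUnion, exists_prop]
  constructor
  · rintro ⟨n, k, hk, hg⟩
    exact ⟨n, k, hk.1, hg⟩
  · rintro ⟨n, k, hk, hg⟩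
    have hp : (0 : ℤ) < P.p n := by exact_mod_cast P.pos n
    have e : ((k % P.p n : ℤ) : ZMod (P.p n)) = k := by simp
    exact ⟨n, k % P.p n, ⟨P.per_congr e.symm hk, Int.emod_nonneg _ hp.ne',
      Int.emod_lt_of_pos _ hp⟩, hg.trans e.symm⟩

theorem diag_mem_openPart (k : ℤ) : P.diag k ∈ P.openPart (η k) := by
  obtain ⟨n, i, hk⟩ := P.toeplitz k
  have := hk 0
  rw [mul_zero, add_zero] at this
  exact P.mem_openPart.2 ⟨n, k, this ▸ hk, rfl⟩

theorem isOpen_openPart (i : Fin 2) : IsOpen (P.openPart i) :=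
  isOpen_iUnion fun n => isOpen_iUnion fun _ => isOpen_iUnion fun _ =>
    (isOpen_discrete {_}).preimage (P.continuous_coord n)

theorem disjoint_openPart : Disjoint (P.openPart 0) (P.openPart 1) := by
  rw [Set.disjoint_left]
  intro g h0 h1
  obtain ⟨m, k, hk, hgk⟩ := P.mem_openPart.1 h0
  -- An integer j with the residue of g at the larger level would have both η j = 0 and η j = 1.
  obtain ⟨n, l, hl, hgl⟩ := P.mem_openPart.1 h1
  obtain ⟨j, hj⟩ := ZMod.intCast_surjective (g.1 (max m n))
  have e : (P.diag j).1 (max m n) = g.1 (max m n) := hj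
  have a0 := P.per_congr (hgk.symm.trans (P.coord_eq_of_le (le_max_left m n) e.symm)) hk 0
  have a1 := P.per_congr (hgl.symm.trans (P.coord_eq_of_le (le_max_right m n) e.symm)) hl 0
  rw [mul_zero, add_zero] at a0 a1
  exact absurd (a0.symm.trans a1) (by decide)

/-- A class of holes takes both values, so each residue g_n has a representative l_n with η(l_n) =
i. Then Δ(l_n) lies in V^i and converges to g. -/
theorem mem_closure_openPart {g : P.odometer} (hg : ∀ n, ∀ k : ℤ, g.1 n = k → k ∈ P.holes n)
    (i : Fin 2) : g ∈ closure (P.openPart i) := by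
  have : ∀ n, ∃ l : ℤ, (l : ZMod (P.p n)) = g.1 n ∧ η l = i := by
    intro n
    obtain ⟨j, hj⟩ := ZMod.intCast_surjective (g.1 n)
    obtain ⟨m, hm⟩ := P.exists_apply_eq_of_mem_holes (hg n j hj.symm) i
    exact ⟨_, by simp [hj], hm⟩
  choose l hl hl' using this
  exact mem_closure_of_tendsto (P.tendsto_of_coord_eq (u := fun n => P.diag (l n)) hl)
    (Eventually.of_forall fun n => hl' n ▸ P.diag_mem_openPart (l n))

/-- The boundary of the window consists of the points all of whose coordinates are holes. -/
theorem mem_bdry {g : P.odometer} :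
    g ∈ P.bdry ↔ ∀ n, ∀ k : ℤ, g.1 n = k → k ∈ P.holes n := by
  have hd : Disjoint (P.openPart 0) P.window :=
    P.disjoint_openPart.closure_right (P.isOpen_openPart 0)
  constructor
  · intro hg n k hk
    refine P.mem_holes.2 (Fin.forall_fin_two.2 ⟨fun h => ?_, fun h => ?_⟩)
    · exact Set.disjoint_left.1 hd (P.mem_openPart.2 ⟨n, k, h, hk⟩)
        (isClosed_closure.frontier_subset hg)
    · exact hg.2 (interior_maximal subset_closure (P.isOpen_openPart 1)
        (P.mem_openPart.2 ⟨n, k, h, hk⟩))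
  · intro hg
    refine ⟨subset_closure (P.mem_closure_openPart hg 1), fun hi => ?_⟩
    -- Points of V^0 accumulate at g, yet V^0 misses W, so g is not interior to W.
    obtain ⟨x, hx, hx0⟩ := mem_closure_iff.1 (P.mem_closure_openPart hg 0) _ isOpen_interior hi
    exact Set.disjoint_left.1 hd hx0 (interior_subset hx)

/-! ### Essential holes and their minimal period. -/

/-- The essential holes at level `n` are the residues modulo `p n` of boundary points. -/
theorem mem_essHoles {n : ℕ} {k : ℤ} : k ∈ P.essHoles n ↔ ∃ g ∈ P.bdry, g.1 n = k := by
  constructor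
  · rintro ⟨-, hk⟩
    -- A boundary point over k is found by Cantor intersection of nested compact sets. Essentiality
    -- of k at level n + m gives a point Δ(k + p_n j) in `C m`.
    let C : ℕ → Set P.odometer := fun m =>
      {g | g.1 n = k} ∩ {g | ∀ l : ℤ, g.1 (n + m) = l → l ∈ P.holes (n + m)}
    have hcl : ∀ m, IsClosed (C m) := fun m =>
      ((isClosed_discrete {x : ZMod (P.p n) | x = k}).preimage (P.continuous_coord n)).inter
      ((isClosed_discrete {x : ZMod (P.p (n + m)) | ∀ l : ℤ, x = l → l ∈ P.holes (n + m)}).preimage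
        (P.continuous_coord (n + m)))
    have hanti : ∀ i j, i ≤ j → ∀ g : P.odometer,
        (∀ l : ℤ, g.1 j = l → l ∈ P.holes j) → ∀ l : ℤ, g.1 i = l → l ∈ P.holes i := by
      intro i j hij g hg l hl
      obtain ⟨a, ha⟩ := ZMod.intCast_surjective (g.1 j)
      exact P.holes_congr ((P.coord_eq_of_le (g := P.diag a) hij ha).trans hl)
        (P.holes_anti hij (hg a ha.symm))
    obtain ⟨g, hg⟩ := IsCompact.nonempty_iInter_of_sequence_nonempty_isCompact_isClosed C
      (fun m g hg => ⟨hg.1, hanti _ _ (by omega) g hg.2⟩)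
      (fun m => by
        obtain ⟨_, hl, j, rfl⟩ := hk (n + m) (Nat.le_add_right n m)
        exact ⟨P.diag (k + P.p n * j), by simp [diag], fun l' h => P.holes_congr h hl⟩)
      (hcl 0).isCompact hcl
    rw [mem_iInter] at hg
    exact ⟨g, P.mem_bdry.2 fun m => hanti m (n + m) (by omega) g (hg m).2, (hg 0).1⟩
  · rintro ⟨g, hg, hk⟩
    rw [mem_bdry] at hg
    refine ⟨hg n k hk, fun m hm => ?_⟩
    obtain ⟨a, ha⟩ := ZMod.intCast_surjective (g.1 m)
    obtain ⟨d, hd⟩ := (ZMod.intCast_eq_intCast_iff_dvd_sub _ _ _).1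
      (hk.symm.trans (P.coord_eq_of_le (h := P.diag a) hm ha.symm))
    exact ⟨a, hg m a ha.symm, d, by linarith⟩

theorem essHoles_congr {n : ℕ} {k l : ℤ} (h : (k : ZMod (P.p n)) = l) :
    k ∈ P.essHoles n ↔ l ∈ P.essHoles n := by
  rw [mem_essHoles, mem_essHoles, h]

/-- The periods form a subgroup of ℤ, so a nonzero remainder of q would be a positive period below
the minimal one. -/
theorem tau_dvd_of_period {n : ℕ} {q : ℤ} (hq : ∀ k, k + q ∈ P.essHoles n ↔ k ∈ P.essHoles n) :
    (P.tau n : ℤ) ∣ q := by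
  let H : AddSubgroup ℤ :=
    { carrier := {q | ∀ k, k + q ∈ P.essHoles n ↔ k ∈ P.essHoles n}
      zero_mem' := by simp
      add_mem' := fun {a b} ha hb k => by rw [← add_assoc, hb, ha]
      neg_mem' := fun {a} ha k => by rw [← ha (k + -a), neg_add_cancel_right] }
  obtain ⟨h0, h1⟩ := P.tau_spec n
  have h0' : (0 : ℤ) < P.tau n := by exact_mod_cast h0
  have hr : q % P.tau n ∈ H := by
    rw [Int.emod_def, mul_comm, ← smul_eq_mul]
    exact H.sub_mem hq (H.zsmul_mem (x := (P.tau n : ℤ)) h1 _)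
  by_contra hnd
  have hpos : 0 < q % P.tau n :=
    lt_of_le_of_ne (Int.emod_nonneg _ h0'.ne') fun h => hnd (Int.dvd_of_emod_eq_zero h.symm)
  have hlt := Int.emod_lt_of_pos q h0'
  lift q % P.tau n to ℕ using hpos.le with r
  have : P.tau n ≤ r := Nat.sInf_le ⟨by exact_mod_cast hpos, hr⟩
  omega

/-- If `∂W + y_F ⊆ ∂W + Δ(k)`, then `τ̃_n` divides `(y_F)_n - k` modulo `p n`. -/
theorem tau_dvd_transl_sub {F : shiftAut η} {k : ℤ} (h : P.BdryShift F k) (n : ℕ) :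
    (P.tau n : ZMod (P.p n)) ∣ (P.transl F).1 n - (k : ZMod (P.p n)) := by
  obtain ⟨y, hy⟩ := ZMod.intCast_surjective ((P.transl F).1 n)
  have hstep : ∀ a, a ∈ P.essHoles n → a + (y - k) ∈ P.essHoles n := by
    intro a ha
    obtain ⟨g, hg, hga⟩ := P.mem_essHoles.1 ha
    obtain ⟨g', hg', e⟩ := h (mem_image_of_mem _ hg)
    have e' : g'.1 n + (k : ZMod (P.p n)) = g.1 n + (P.transl F).1 n :=
      congrArg (fun x : P.odometer => x.1 n) e
    refine P.mem_essHoles.2 ⟨g', hg', ?_⟩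
    push_cast
    rw [hy, ← hga]
    linear_combination e'
  have hiter : ∀ (j : ℕ) a, a ∈ P.essHoles n → a + j * (y - k) ∈ P.essHoles n := by
    intro j
    induction j with
    | zero => intro a ha; simpa using ha
    | succ j ih =>
      intro a ha
      have := hstep _ (ih a ha)
      have e : a + j * (y - k) + (y - k) = a + (j + 1 : ℕ) * (y - k) := by push_cast; ring
      rwa [e] at this
  -- Only one inclusion is given. The other holds because p_n - 1 further steps undo one step modulo
  -- p_n.
  have hper : ∀ a, a + (y - k) ∈ P.essHoles n ↔ a ∈ P.essHoles n := by
    refine fun a => ⟨fun ha => ?_, hstep a⟩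
    have := hiter (P.p n - 1) _ ha
    refine (P.essHoles_congr ?_).1 this
    have hc : ((P.p n - 1 : ℕ) : ZMod (P.p n)) = -1 := by
      rw [Nat.cast_sub (P.pos n)]; simp
    push_cast
    rw [hc]
    ring
  obtain ⟨d, hd⟩ := P.tau_dvd_of_period hper
  refine ⟨d, ?_⟩
  rw [← hy]
  exact_mod_cast congrArg (Int.cast : ℤ → ZMod (P.p n)) hd

/-! ### The homomorphism from the centralizer to the odometer -/

theorem transl_mul (F F' : shiftAut η) : P.transl (F * F') = P.transl F + P.transl F' := by
  change P.factorMap (F.1 (F'.1 (basePoint η))) = _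
  rw [factorMap_apply_aut, add_comm]
  rfl

/-- The homomorphism `F ↦ y_F`. -/
noncomputable def translHom : shiftAut η →* Multiplicative P.odometer :=
  MonoidHom.mk' (fun F => Multiplicative.ofAdd (P.transl F)) P.transl_mul

theorem transl_shiftAutGen : P.transl (shiftAutGen η) = P.diag 1 := by
  change P.factorMap (subshift η (basePoint η)) = _
  rw [factorMap_shift, factorMap_basePoint, map_zero, zero_add]

theorem transl_zpow (F : shiftAut η) (k : ℤ) : P.transl (F ^ k) = k • P.transl F :=
  congrArg Multiplicative.toAdd (map_zpow P.translHom F k)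

theorem transl_shiftAutGen_zpow (k : ℤ) : P.transl (shiftAutGen η ^ k) = P.diag k := by
  rw [transl_zpow, transl_shiftAutGen, ← map_zsmul, smul_eq_mul, mul_one]

theorem factorMap_shiftOrbit (m : ℤ) :
    P.factorMap ⟨shiftOrbit η m, subset_closure ⟨m, rfl⟩⟩ = P.diag m := by
  have hs : ∀ m : ℤ, P.factorMap ⟨shiftOrbit η (m + 1), subset_closure ⟨m + 1, rfl⟩⟩ =
      P.factorMap ⟨shiftOrbit η m, subset_closure ⟨m, rfl⟩⟩ + P.diag 1 := by
    intro m
    rw [← factorMap_shift]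
    congr 1
    apply Subtype.ext
    funext k
    change η (k + (m + 1)) = η (k + 1 + m)
    congr 1; ring
  induction m using Int.induction_on with
  | zero =>
    rw [← factorMap_basePoint]
    congr 1
    apply Subtype.ext
    funext k
    simp [shiftOrbit, basePoint]
  | succ m ih => rw [hs, ih, ← map_add]
  | pred m ih =>
    have := hs (-m - 1)
    simp only [sub_add_cancel, ih] at this
    rw [map_sub, this, add_sub_cancel_right]

/-- The fibre of the factor map over `0` is `{η}`. -/
theorem eq_basePoint_of_factorMap_eq_zero {x : orbitClosure η} (hx : P.factorMap x = 0) :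
    x = basePoint η := by
  apply Subtype.ext
  funext k
  obtain ⟨n, i, hk⟩ := P.toeplitz k
  -- An orbit point σ^m η in this neighbourhood of x has p_n ∣ m, so its symbol at the p_n-periodic
  -- position k is η k.
  have hU : IsOpen {y : orbitClosure η | y.1 k = x.1 k ∧ (P.factorMap y).1 n = 0} := by
    have hc : Continuous fun y : orbitClosure η => y.1 k :=
      (continuous_apply k).comp continuous_subtype_val
    exact ((isOpen_discrete {x.1 k}).preimage hc).inter
      ((isOpen_discrete {(0 : ZMod (P.p n))}).preimage
        ((P.continuous_coord n).comp P.factorMap.continuous))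
  obtain ⟨m, hm, hm'⟩ := denseRange_orbit.exists_mem_open hU ⟨x, rfl, by rw [hx]; rfl⟩
  rw [factorMap_shiftOrbit] at hm'
  obtain ⟨d, rfl⟩ := (ZMod.intCast_zmod_eq_zero_iff_dvd _ _).1 hm'
  have h0 := hk 0
  rw [mul_zero, add_zero] at h0
  exact hm.symm.trans ((hk d).trans h0.symm)

/-- If y_F = 0, then F fixes η by the one-point fibre. The fixed points of F form a closed
shift-invariant set, hence all of X_η. -/
theorem transl_injective : Function.Injective P.transl := by
  refine (injective_iff_map_eq_one P.translHom).2 fun F hF => ?_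
  have h0 : F.1 (basePoint η) = basePoint η := P.eq_basePoint_of_factorMap_eq_zero hF
  have hF : ∀ y, F.1 (subshift η y) = subshift η (F.1 y) := fun y =>
    (DFunLike.congr_fun (Subgroup.mem_centralizer_singleton_iff.1 F.2) y)
  refine Subtype.ext (Homeomorph.ext fun x => ?_)
  refine orbit_induction (C := {x | F.1 x = x}) (isClosed_eq F.1.continuous continuous_id)
    h0 (fun y => ?_) x
  rw [mem_ofPred_eq, mem_ofPred_eq, hF, (subshift η).injective.eq_iff]

/-! ### Boundary shifts -/

theorem BdryShift.mul {F F' : shiftAut η} {k k' : ℤ} (h : P.BdryShift F k)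
    (h' : P.BdryShift F' k') : P.BdryShift (F * F') (k + k') := by
  rintro _ ⟨g, hg, rfl⟩
  obtain ⟨g₁, hg₁, e₁⟩ := h (mem_image_of_mem _ hg)
  obtain ⟨g₂, hg₂, e₂⟩ := h' (mem_image_of_mem _ hg₁)
  refine ⟨g₂, hg₂, ?_⟩
  simp only at e₁ e₂ ⊢
  rw [transl_mul, map_add, ← add_assoc g, ← e₁, add_right_comm g₁, ← e₂]
  abel

theorem bdryShift_shiftAutGen_zpow (k : ℤ) : P.BdryShift (shiftAutGen η ^ k) k := by
  rw [BdryShift, transl_shiftAutGen_zpow]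

/-- The homomorphism `F ↦ k_F`. -/
noncomputable def bdryShiftHom (h : ∀ F : shiftAut η, ∃! k : ℤ, P.BdryShift F k) :
    shiftAut η →* Multiplicative ℤ :=
  MonoidHom.mk' (fun F => Multiplicative.ofAdd (h F).choose) fun F F' =>
    -- The sum k_F + k_F' also works for F * F', so uniqueness gives additivity.
    ((h (F * F')).unique ((h F).choose_spec.1.mul P (h F').choose_spec.1)
      (h (F * F')).choose_spec.1).symm

theorem bdryShiftHom_spec (h : ∀ F : shiftAut η, ∃! k : ℤ, P.BdryShift F k) (F : shiftAut η) :
    P.BdryShift F (P.bdryShiftHom h F).toAdd :=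
  (h F).choose_spec.1

theorem bdryShiftHom_zpow (h : ∀ F : shiftAut η, ∃! k : ℤ, P.BdryShift F k) (k : ℤ) :
    P.bdryShiftHom h (shiftAutGen η ^ k) = Multiplicative.ofAdd k :=
  (h _).unique (P.bdryShiftHom_spec h _) (P.bdryShift_shiftAutGen_zpow k)

/-! ### The kernel of F ↦ k_F as a finite cyclic group. -/

theorem transl_mem_zmultiples (h : ∀ F : shiftAut η, ∃! k : ℤ, P.BdryShift F k) {F : shiftAut η}
    (hF : F ∈ (P.bdryShiftHom h).ker) (n : ℕ) :
    (P.transl F).1 n ∈ AddSubgroup.zmultiples (P.tau n : ZMod (P.p n)) := by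
  have h1 := P.bdryShiftHom_spec h F
  rw [MonoidHom.mem_ker.1 hF] at h1
  obtain ⟨c, hc⟩ := P.tau_dvd_transl_sub h1 n
  obtain ⟨c, rfl⟩ := ZMod.intCast_surjective c
  refine AddSubgroup.mem_zmultiples_iff.2 ⟨c, ?_⟩
  simpa [mul_comm] using hc.symm

/-- The `n`-th coordinate of the translation, on the kernel of `F ↦ k_F`. -/
noncomputable def kerCoord (h : ∀ F : shiftAut η, ∃! k : ℤ, P.BdryShift F k) (n : ℕ) :
    (P.bdryShiftHom h).ker →*
      Multiplicative (AddSubgroup.zmultiples (P.tau n : ZMod (P.p n))) :=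
  MonoidHom.mk' (fun F => Multiplicative.ofAdd
    ⟨(P.transl F.1).1 n, P.transl_mem_zmultiples h F.2 n⟩) fun F F' =>
      Subtype.ext (congrArg (fun g : P.odometer => g.1 n) (P.transl_mul F.1 F'.1))

/-- Agreement at infinitely many levels would force equal translations, hence equal automorphisms.
-/
theorem eventually_kerCoord_ne (h : ∀ F : shiftAut η, ∃! k : ℤ, P.BdryShift F k)
    {F F' : (P.bdryShiftHom h).ker} (hne : F ≠ F') :
    ∀ᶠ n in atTop, P.kerCoord h n F ≠ P.kerCoord h n F' := by
  by_contra hcon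
  refine hne (Subtype.ext (P.transl_injective (P.ext_of_infinite
    (Nat.frequently_atTop_iff_infinite.1 (not_eventually.1 hcon)) fun n hn => ?_)))
  exact congrArg Subtype.val (not_not.1 hn)

theorem card_zmultiples_tau (n : ℕ) :
    Nat.card (Multiplicative (AddSubgroup.zmultiples (P.tau n : ZMod (P.p n)))) =
      P.p n / P.tau n := by
  rw [Nat.card_congr Multiplicative.toAdd, Nat.card_zmultiples,
    ZMod.addOrderOf_coe _ (P.pos n).ne', Nat.gcd_eq_right (P.tau_dvd n)]

/-- Separation of the finitely many pairs holds at all large levels, so it meets the infinitely many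
levels with quotient M. -/
theorem exists_injOn_kerCoord (h : ∀ F : shiftAut η, ∃! k : ℤ, P.BdryShift F k) {M : ℕ}
    (hM : ∃ᶠ n in atTop, P.p n / P.tau n = M) (s : Finset (P.bdryShiftHom h).ker) :
    ∃ n, P.p n / P.tau n = M ∧ Set.InjOn (P.kerCoord h n) s := by
  have : ∀ᶠ n in atTop, ∀ F ∈ s, ∀ F' ∈ s, F ≠ F' → P.kerCoord h n F ≠ P.kerCoord h n F' := by
    simp only [eventually_all_finset]
    exact fun F _ F' _ => by
      by_cases hne : F = F'
      · exact Eventually.of_forall fun _ h => absurd hne h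
      · filter_upwards [P.eventually_kerCoord_ne h hne] with n hn _ using hn
  obtain ⟨n, hn, hinj⟩ := (hM.and_eventually this).exists
  exact ⟨n, hn, fun F hF F' hF' e => by_contra fun hne => hinj F hF F' hF' hne e⟩

theorem finite_ker_bdryShiftHom (h : ∀ F : shiftAut η, ∃! k : ℤ, P.BdryShift F k) {M : ℕ}
    (hM : ∃ᶠ n in atTop, P.p n / P.tau n = M) : Finite (P.bdryShiftHom h).ker := by
  by_contra hinf
  rw [not_finite_iff_infinite] at hinf
  -- These M + 1 elements would inject into a group of order M.
  obtain ⟨s, hs⟩ := Infinite.exists_subset_card_eq (P.bdryShiftHom h).ker (M + 1)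
  obtain ⟨n, hn, hinj⟩ := P.exists_injOn_kerCoord h hM s
  have : Nat.card s ≤ _ := Nat.card_le_card_of_injective _ hinj.injective
  rw [card_zmultiples_tau, hn] at this
  simp [hs] at this

theorem isCyclic_ker_bdryShiftHom (h : ∀ F : shiftAut η, ∃! k : ℤ, P.BdryShift F k) {M : ℕ}
    (hM : ∃ᶠ n in atTop, P.p n / P.tau n = M) :
    IsCyclic (P.bdryShiftHom h).ker ∧ Nat.card (P.bdryShiftHom h).ker ∣ M := by
  have := P.finite_ker_bdryShiftHom h hM
  have := Fintype.ofFinite (P.bdryShiftHom h).ker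
  obtain ⟨n, hn, hinj⟩ := P.exists_injOn_kerCoord h hM Finset.univ
  have hinj : Function.Injective (P.kerCoord h n) := by simpa using hinj
  refine ⟨isCyclic_of_injective _ hinj, ?_⟩
  rw [← hn, ← card_zmultiples_tau]
  exact Subgroup.card_dvd_of_injective _ hinj

theorem mem_ker_bdryShiftHom (h : ∀ F : shiftAut η, ∃! k : ℤ, P.BdryShift F k) {M : ℕ}
    (hM : ∃ᶠ n in atTop, P.p n / P.tau n = M) (F : shiftAut η) :
    F ∈ (P.bdryShiftHom h).ker ↔ IsOfFinOrder F := by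
  constructor
  · intro hF
    have := P.finite_ker_bdryShiftHom h hM
    exact (Subgroup.subtype _).isOfFinOrder
      (isOfFinOrder_of_finite (⟨F, hF⟩ : (P.bdryShiftHom h).ker))
  · intro hF
    obtain ⟨k, hk, e⟩ := isOfFinOrder_iff_pow_eq_one.1 ((P.bdryShiftHom h).isOfFinOrder hF)
    have e' : k • (P.bdryShiftHom h F).toAdd = 0 := congrArg Multiplicative.toAdd e
    exact (smul_eq_zero.1 e').resolve_left hk.ne'

/-! ### The splitting of the centralizer. -/

theorem shiftAut_mul_comm (P : PeriodStructure η) (F F' : shiftAut η) : F * F' = F' * F :=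
  P.transl_injective (by rw [transl_mul, transl_mul, add_comm])

/-- Since k ↦ σ^k is a section of F ↦ k_F, each F factors as σ^{k_F} times a kernel element, and
applying F ↦ k_F shows that the factors are unique. -/
theorem exists_mulEquiv (h : ∀ F : shiftAut η, ∃! k : ℤ, P.BdryShift F k) :
    ∃ e : Subgroup.zpowers (shiftAutGen η) × (P.bdryShiftHom h).ker ≃* shiftAut η,
      ∀ s t, e (s, t) = (s : shiftAut η) * (t : shiftAut η) := by
  let f : Subgroup.zpowers (shiftAutGen η) × (P.bdryShiftHom h).ker →* shiftAut η :=
    MonoidHom.noncommCoprod (Subgroup.subtype _) (Subgroup.subtype _)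
      fun _ _ => P.shiftAut_mul_comm _ _
  have hf : Function.Bijective f := by
    constructor
    · refine (injective_iff_map_eq_one f).2 ?_
      rintro ⟨⟨_, k, rfl⟩, t, ht⟩ e
      replace e : shiftAutGen η ^ k * t = 1 := e
      have e' := congrArg (P.bdryShiftHom h) e
      rw [map_mul, bdryShiftHom_zpow, MonoidHom.mem_ker.1 ht, mul_one, map_one] at e'
      obtain rfl : k = 0 := e'
      rw [zpow_zero, one_mul] at e
      subst e
      exact Prod.ext (Subtype.ext (zpow_zero _)) rfl
    · intro F
      refine ⟨⟨⟨shiftAutGen η ^ (P.bdryShiftHom h F).toAdd, _, rfl⟩,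
        ⟨(shiftAutGen η ^ (P.bdryShiftHom h F).toAdd)⁻¹ * F, ?_⟩⟩, mul_inv_cancel_left _ _⟩
      rw [MonoidHom.mem_ker, map_mul, map_inv, bdryShiftHom_zpow, ofAdd_toAdd, inv_mul_cancel]
  exact ⟨MulEquiv.ofBijective f hf, fun _ _ => rfl⟩

end PeriodStructure

/-! ### Attained lower limits and the main theorem. -/

/-- A sequence of natural numbers attains a finite lower limit infinitely often. -/
theorem frequently_eq_of_liminf_eq {a : ℕ → ℕ} {M : ℕ}
    (h : liminf (fun n => (a n : ℕ∞)) atTop = (M : ℕ∞)) : ∃ᶠ n in atTop, a n = M := by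
  have h1 : ∃ᶠ n in atTop, (a n : ℕ∞) < (M + 1 : ℕ) :=
    frequently_lt_of_liminf_lt (by isBoundedDefault) (by rw [h]; exact_mod_cast M.lt_succ_self)
  have h2 : ∀ᶠ n in atTop, M ≤ a n := by
    rcases M with _ | M
    · simp
    · filter_upwards [eventually_lt_of_lt_liminf (b := (M : ℕ∞))
        (by rw [h]; exact_mod_cast M.lt_succ_self) (by isBoundedDefault)] with n hn
      exact_mod_cast hn
  refine (h1.and_eventually h2).mono fun n hn => ?_
  have : a n < M + 1 := by exact_mod_cast hn.1
  omega

theorem theorem2p6 (η : ℤ → Fin 2) (hη : ∀ q : ℤ, 0 < q → ¬ Function.Periodic η q)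
    (P : PeriodStructure η) :
    -- part a), first claim
    (∀ (F : shiftAut η) (k : ℤ), P.BdryShift F k →
      ∀ n, (P.tau n : ZMod (P.p n)) ∣ (P.transl F).1 n - (k : ZMod (P.p n))) ∧
    -- part a), second claim
    ((∀ F : shiftAut η, ∃ k : ℤ, P.BdryShift F k) → {n | P.tau n = P.p n}.Infinite →
      ∀ F : shiftAut η, F ∈ Subgroup.zpowers (shiftAutGen η)) ∧
    -- part b)
    ((∀ F : shiftAut η, ∃! k : ℤ, P.BdryShift F k) →
      ∀ M : ℕ, liminf (fun n => ((P.p n / P.tau n : ℕ) : ℕ∞)) atTop = (M : ℕ∞) →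
        ∃ Tor : Subgroup (shiftAut η),
          (∀ F, F ∈ Tor ↔ IsOfFinOrder F) ∧
          (∃ e : Subgroup.zpowers (shiftAutGen η) × Tor ≃* shiftAut η,
            ∀ s t, e (s, t) = (s : shiftAut η) * (t : shiftAut η)) ∧
          IsCyclic Tor ∧ Finite Tor ∧ Nat.card Tor ∣ M) := by
  refine ⟨fun F k h n => P.tau_dvd_transl_sub h n, fun h hτ F => ?_, fun h M hM => ?_⟩
  · obtain ⟨k, hk⟩ := h F
    refine Subgroup.mem_zpowers_iff.2 ⟨k, P.transl_injective ?_⟩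
    rw [P.transl_shiftAutGen_zpow]
    refine P.ext_of_infinite hτ fun n hn => ?_
    have hd := P.tau_dvd_transl_sub hk n
    -- Here τ̃_n is 0 in ℤ/p_nℤ, so the divisibility becomes (y_F)_n = k.
    rw [show P.tau n = P.p n from hn, ZMod.natCast_self, zero_dvd_iff, sub_eq_zero] at hd
    exact hd.symm
  · have hM := frequently_eq_of_liminf_eq hM
    obtain ⟨hcyc, hcard⟩ := P.isCyclic_ker_bdryShiftHom h hM
    exact ⟨(P.bdryShiftHom h).ker, P.mem_ker_bdryShiftHom h hM, P.exists_mulEquiv h, hcyc,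
      P.finite_ker_bdryShiftHom h hM, hcard⟩
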